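/- For matrices $b\in M_3(\mathbb C)$ let $\|b\|$ be the operator norm and $\|b\|_1=\operatorname{Tr}(b^*b)^{1/2}$ the trace norm. On $M_3(\mathbb C)\otimes M_3(\mathbb C)$ let $$\pi(x)=\inf\Big\{\sum_i\|a_i\|\,\|b_i\|_1 : x=\sum_i a_i\otimes b_i\ \text{(finite sum)}\Big\},\qquad \alpha(\rho)=\sup_{a\ne 0}\frac{|\operatorname{Tr}(\rho a)|}{\pi(a)}$$ be the projective norm and its dual norm with respect to the trace pairing. Let $$\mathfrak D=\big\{\rho\in M_3(\mathbb C)\otimes M_3(\mathbb C) : \rho=\rho^*,\ \alpha(\rho)=1,\ (x\otimes y,\rho\, x\otimes y)\ge 0\ \text{for all } x,y\in\mathbb C^3,\ \operatorname{Tr}\rho=3\big\}$$ (the set of Choi matrices $\sum_{ij}E_{ij}\otimes\phi(E_{ij})$ of the normalized unital positive maps $\phi$ of $M_3(\mathbb C)$). A point $\rho\in\mathfrak D$ is an exposed point of $\mathfrak D$ if there is a real-linear functional $\omega$ with $\omega(\sigma)<\omega(\rho)$ for every $\sigma\in\mathfrak D$, $\sigma\neq\rho$. Then: (i) every symmetry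 $s\in\mathfrak D$, i.e. every $s\in\mathfrak D$ with $s=s^*$ and $s^2=1$, is an exposed point of $\mathfrak D$; (ii) for every maximally entangled vector $x\in\mathbb C^3\otimes\mathbb C^3$, i.e. $x=\frac1{\sqrt3}\sum_{k=1}^3 f_k\otimes g_k$ with orthonormal bases $(f_k)$, $(g_k)$ of $\mathbb C^3$, the matrix $3P_x$ belongs to $\mathfrak D$ and is an exposed point of $\mathfrak D$, where $P_x$ is the orthogonal projector onto $\mathbb C x$. -/

import Mathlib

open scoped Kronecker ComplexOrder MatrixOrder Matrix

/-- The matrix algebra `M_n(ℂ)`. -/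
abbrev Mat (n : ℕ) : Type := Matrix (Fin n) (Fin n) ℂ

/-- The algebra `M_n(ℂ) ⊗ M_n(ℂ)`, realised by matrices indexed by pairs; the elementary tensor
`a ⊗ b` is the Kronecker product `a ⊗ₖ b`. -/
abbrev Mat2 (n : ℕ) : Type := Matrix (Fin n × Fin n) (Fin n × Fin n) ℂ

/-- Operator norm of a matrix acting on the Hilbert space `ℂⁿ`. -/
noncomputable def opNorm {n : ℕ} (a : Mat n) : ℝ :=
  ‖Matrix.toEuclideanCLM (n := Fin n) (𝕜 := ℂ) a‖

/-- Trace norm `‖b‖₁ = Tr (b* b)^{1/2}` (the trace is a nonnegative real number). -/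
noncomputable def traceNorm {n : ℕ} (b : Mat n) : ℝ :=
  (Matrix.trace (CFC.sqrt (bᴴ * b))).re

/-- Projective norm on `M_n ⊗ M_n`, with the operator norm on the first factor and the trace norm
on the second one. -/
noncomputable def projNorm {n : ℕ} (x : Mat2 n) : ℝ :=
  sInf {r : ℝ | ∃ (k : ℕ) (a b : Fin k → Mat n),
    x = ∑ i, a i ⊗ₖ b i ∧ r = ∑ i, opNorm (a i) * traceNorm (b i)}

/-- The norm `α`, dual to the projective norm with respect to the trace pairing. -/
noncomputable def alphaNorm {n : ℕ} (ρ : Mat2 n) : ℝ :=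
  sSup {r : ℝ | ∃ a : Mat2 n, a ≠ 0 ∧ r = ‖Matrix.trace (ρ * a)‖ / projNorm a}

/-- The product vector `x ⊗ y` in `ℂⁿ ⊗ ℂⁿ`. -/
def tensorVec {n : ℕ} (x y : Fin n → ℂ) : Fin n × Fin n → ℂ := fun p => x p.1 * y p.2

/-- Block positivity: `(x ⊗ y, ρ (x ⊗ y)) ≥ 0` for all `x`, `y`. -/
def IsBlockPositive {n : ℕ} (ρ : Mat2 n) : Prop :=
  ∀ x y : Fin n → ℂ, 0 ≤ star (tensorVec x y) ⬝ᵥ (ρ *ᵥ tensorVec x y)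

/-- The set `𝔇` of Choi matrices of normalized unital positive maps of `M_n(ℂ)`. -/
def choiSet (n : ℕ) : Set (Mat2 n) :=
  {ρ | ρ.IsHermitian ∧ alphaNorm ρ = 1 ∧ IsBlockPositive ρ ∧ Matrix.trace ρ = n}

/-- A symmetry is a selfadjoint unitary. -/
def IsSymmetry {n : ℕ} (s : Mat2 n) : Prop := s.IsHermitian ∧ s * s = 1

/-- A vector of `ℂⁿ ⊗ ℂⁿ` is maximally entangled if it equals `n^{-1/2} ∑ₖ fₖ ⊗ gₖ` for some
orthonormal bases `f`, `g` of `ℂⁿ`. -/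
def IsMaximallyEntangled {n : ℕ} (x : Fin n × Fin n → ℂ) : Prop :=
  ∃ f g : OrthonormalBasis (Fin n) ℂ (EuclideanSpace ℂ (Fin n)),
    x = ((1 / Real.sqrt n : ℝ) : ℂ) • ∑ k, tensorVec (fun i => f k i) (fun j => g k j)

/-- The rank one operator `|x⟩⟨x|`; for a unit vector `x` it is the orthogonal projector `P_x`
onto the line spanned by `x`. -/
def ketBra {n : ℕ} (x : Fin n × Fin n → ℂ) : Mat2 n := Matrix.vecMulVec x (star x)

/-!
Let `φ` be the linear map on `M_n(ℂ)` with Choi matrix `ρ`. Testing `α(ρ)` on `uᵀ ⊗ φ(u)*` for a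
unitary `u`, and using `‖b‖₁² ≤ n Tr (b* b)`, gives `Tr (φ(u)* φ(u)) ≤ n α(ρ)²`. The `n²` Weyl
unitaries are an orthogonal basis of `M_n(ℂ)`, so adding these bounds over them yields
`Tr (ρ* ρ) ≤ (n α(ρ))²`: the unit ball of `α` lies in the Hilbert–Schmidt ball of radius `n`. By
strict convexity of the latter, every point of the `α`-ball of Hilbert–Schmidt norm `n` is exposed,
and unitaries of `M_n ⊗ M_n` as well as the matrices `n P_x` have exactly that norm. Finally, if
`√n x` is the vectorization of the unitary `v`, then `Tr (n P_x (a ⊗ b)) = Tr (v aᵀ v* b)`, so that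
`α(n P_x) ≤ 1` by the duality of the operator and trace norms.
-/

section HilbertSchmidt

variable {m n : Type*} [Fintype m] [Fintype n]

theorem trace_conjTranspose_mul_self_re (A : Matrix m n ℂ) :
    (Aᴴ * A).trace.re = ∑ i, ∑ j, ‖A i j‖ ^ 2 := by
  simp only [Matrix.trace, Matrix.diag_apply, Matrix.mul_apply, Matrix.conjTranspose_apply,
    Complex.star_def, Complex.conj_mul', Complex.re_sum]
  rw [Finset.sum_comm]
  norm_cast

theorem trace_conjTranspose_mul_self_re_nonneg (A : Matrix m n ℂ) :
    0 ≤ (Aᴴ * A).trace.re := by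
  rw [trace_conjTranspose_mul_self_re]
  positivity

theorem eq_zero_of_trace_conjTranspose_mul_self_re_eq_zero {A : Matrix m n ℂ}
    (h : (Aᴴ * A).trace.re = 0) : A = 0 := by
  refine Matrix.trace_conjTranspose_mul_self_eq_zero_iff.1 (Complex.ext h ?_)
  exact (Complex.nonneg_iff.1 (Matrix.posSemidef_conjTranspose_mul_self A).trace_nonneg).2.symm

theorem norm_trace_sq_le (A : Matrix m m ℂ) :
    ‖A.trace‖ ^ 2 ≤ Fintype.card m * (Aᴴ * A).trace.re := by
  rw [trace_conjTranspose_mul_self_re]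
  calc ‖A.trace‖ ^ 2 ≤ (∑ i, ‖A i i‖) ^ 2 := by
        gcongr
        exact norm_sum_le _ _
    _ ≤ Fintype.card m * ∑ i, ‖A i i‖ ^ 2 := sq_sum_le_card_mul_sum_sq
    _ ≤ Fintype.card m * ∑ i, ∑ j, ‖A i j‖ ^ 2 := by
        gcongr with i
        exact Finset.single_le_sum (f := fun j => ‖A i j‖ ^ 2) (fun _ _ => by positivity)
          (Finset.mem_univ i)

/-- The real-linear functional `B ↦ Re Tr (A* B)`. -/
noncomputable def reTraceDual (A : Matrix m n ℂ) : StrongDual ℝ (Matrix m n ℂ) where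
  toFun B := (Aᴴ * B).trace.re
  map_add' B C := by simp [Matrix.mul_add]
  map_smul' c B := by simp
  cont := Complex.continuous_re.comp (by fun_prop)

theorem mem_exposedPoints_of_forall_trace_le {S : Set (Matrix m n ℂ)} {A : Matrix m n ℂ}
    (hA : A ∈ S)
    (hS : ∀ B ∈ S, (Bᴴ * B).trace.re ≤ (Aᴴ * A).trace.re) : A ∈ S.exposedPoints ℝ := by
  have expand (B : Matrix m n ℂ) : ((A - B)ᴴ * (A - B)).trace.re =
      (Aᴴ * A).trace.re + (Bᴴ * B).trace.re - 2 * (Aᴴ * B).trace.re := by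
    have hBA : (Bᴴ * A).trace.re = (Aᴴ * B).trace.re := by
      rw [← Matrix.conjTranspose_conjTranspose A, ← Matrix.conjTranspose_mul,
        Matrix.trace_conjTranspose, Complex.star_def, Complex.conj_re,
        Matrix.conjTranspose_conjTranspose]
    simp only [Matrix.conjTranspose_sub, Matrix.sub_mul, Matrix.mul_sub, Matrix.trace_sub,
      Complex.sub_re, hBA]
    ring
  have le_self (B : Matrix m n ℂ) (hB : B ∈ S) : (Aᴴ * B).trace.re ≤ (Aᴴ * A).trace.re := by
    linarith [expand B, hS B hB, trace_conjTranspose_mul_self_re_nonneg (A - B)]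
  refine ⟨hA, reTraceDual A, fun B hB => ⟨le_self B hB, fun hle => ?_⟩⟩
  replace hle : (Aᴴ * A).trace.re ≤ (Aᴴ * B).trace.re := hle
  have hzero : ((A - B)ᴴ * (A - B)).trace.re = 0 :=
    le_antisymm (by linarith [expand B, hS B hB]) (trace_conjTranspose_mul_self_re_nonneg _)
  exact (sub_eq_zero.1 (eq_zero_of_trace_conjTranspose_mul_self_re_eq_zero hzero)).symm

end HilbertSchmidt

section OperatorNorm

variable {n : ℕ}

open scoped Matrix.Norms.L2Operator in
theorem opNorm_eq_norm (a : Mat n) : opNorm a = ‖a‖ := rfl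

theorem opNorm_nonneg (a : Mat n) : 0 ≤ opNorm a := norm_nonneg _

theorem norm_mulVec_le_opNorm_mul (a : Mat n) (x : Fin n → ℂ) :
    ‖WithLp.toLp 2 (a *ᵥ x)‖ ≤ opNorm a * ‖WithLp.toLp 2 x‖ :=
  (Matrix.toEuclideanCLM (n := Fin n) (𝕜 := ℂ) a).le_opNorm (WithLp.toLp 2 x)

theorem norm_apply_le_opNorm (a : Mat n) (i k : Fin n) : ‖a i k‖ ≤ opNorm a := by
  have h := norm_mulVec_le_opNorm_mul a (Pi.single k 1)
  rw [Matrix.mulVec_single_one, PiLp.toLp_single, PiLp.norm_single, norm_one, mul_one] at h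
  exact (PiLp.norm_apply_le (WithLp.toLp 2 (a.col k)) i).trans h

theorem opNorm_transpose_le (a : Mat n) : opNorm aᵀ ≤ opNorm a := by
  have norm_star (x : Fin n → ℂ) : ‖WithLp.toLp 2 (star x)‖ = ‖WithLp.toLp 2 x‖ := by
    simp [EuclideanSpace.norm_eq]
  rw [opNorm_eq_norm, ← Matrix.l2_opNorm_conjTranspose]
  refine ContinuousLinearMap.opNorm_le_bound _ (opNorm_nonneg a) fun x => ?_
  have conj_mulVec : aᵀᴴ *ᵥ x.ofLp = star (a *ᵥ star x.ofLp) := by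
    rw [Matrix.star_mulVec, star_star, ← Matrix.mulVec_transpose]
    rfl
  change ‖WithLp.toLp 2 (aᵀᴴ *ᵥ x.ofLp)‖ ≤ opNorm a * ‖WithLp.toLp 2 x.ofLp‖
  rw [conj_mulVec, norm_star, ← norm_star x.ofLp]
  exact norm_mulVec_le_opNorm_mul a _

open scoped Matrix.Norms.L2Operator in
theorem opNorm_mul_mem_unitaryGroup (a : Mat n) {u : Mat n}
    (hu : u ∈ Matrix.unitaryGroup (Fin n) ℂ) : opNorm (a * u) = opNorm a :=
  CStarRing.norm_mul_mem_unitary a hu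

open scoped Matrix.Norms.L2Operator in
theorem opNorm_mem_unitaryGroup_mul {u : Mat n} (a : Mat n)
    (hu : u ∈ Matrix.unitaryGroup (Fin n) ℂ) : opNorm (u * a) = opNorm a :=
  CStarRing.norm_mem_unitary_mul a hu

theorem opNorm_one_le : opNorm (1 : Mat n) ≤ 1 := by
  rw [opNorm, map_one]
  exact ContinuousLinearMap.norm_id_le

theorem opNorm_le_one_of_mem_unitaryGroup {u : Mat n}
    (hu : u ∈ Matrix.unitaryGroup (Fin n) ℂ) : opNorm u ≤ 1 := by
  rw [← mul_one u, opNorm_mem_unitaryGroup_mul 1 hu]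
  exact opNorm_one_le

theorem opNorm_single_one_le (i k : Fin n) : opNorm (Matrix.single i k 1 : Mat n) ≤ 1 := by
  refine ContinuousLinearMap.opNorm_le_bound _ zero_le_one fun x => ?_
  have mulVec_eq : (Matrix.single i k 1 : Mat n) *ᵥ x.ofLp = Pi.single i (x k) := by
    rw [Matrix.single_mulVec, one_mul]
    rfl
  change ‖WithLp.toLp 2 ((Matrix.single i k 1 : Mat n) *ᵥ x.ofLp)‖ ≤ 1 * ‖x‖
  rw [mulVec_eq, PiLp.toLp_single, PiLp.norm_single, one_mul]
  exact PiLp.norm_apply_le x k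

end OperatorNorm

section TraceNorm

variable {n : ℕ}

theorem posSemidef_sqrt_conjTranspose_mul_self (b : Mat n) :
    (CFC.sqrt (bᴴ * b)).PosSemidef :=
  Matrix.nonneg_iff_posSemidef.1 (CFC.sqrt_nonneg _)

theorem conjTranspose_sqrt_mul_sqrt (b : Mat n) :
    (CFC.sqrt (bᴴ * b))ᴴ * CFC.sqrt (bᴴ * b) = bᴴ * b := by
  rw [(posSemidef_sqrt_conjTranspose_mul_self b).isHermitian.eq]
  exact CFC.sqrt_mul_sqrt_self _
    (Matrix.nonneg_iff_posSemidef.2 (Matrix.posSemidef_conjTranspose_mul_self b))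

theorem traceNorm_nonneg (b : Mat n) : 0 ≤ traceNorm b :=
  (Complex.nonneg_iff.1 (posSemidef_sqrt_conjTranspose_mul_self b).trace_nonneg).1

theorem traceNorm_one : traceNorm (1 : Mat n) = n := by
  simp [traceNorm]

theorem traceNorm_sq_le (b : Mat n) : traceNorm b ^ 2 ≤ n * (bᴴ * b).trace.re := by
  calc traceNorm b ^ 2 ≤ ‖(CFC.sqrt (bᴴ * b)).trace‖ ^ 2 := by
        gcongr
        · exact traceNorm_nonneg b
        · exact Complex.re_le_norm _
    _ ≤ n * (bᴴ * b).trace.re := by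
        simpa only [conjTranspose_sqrt_mul_sqrt, Fintype.card_fin] using
          norm_trace_sq_le (CFC.sqrt (bᴴ * b))

theorem norm_mulVec_eq_of_conjTranspose_mul_self_eq {a b : Mat n} (h : aᴴ * a = bᴴ * b)
    (x : Fin n → ℂ) : ‖WithLp.toLp 2 (a *ᵥ x)‖ = ‖WithLp.toLp 2 (b *ᵥ x)‖ := by
  have inner_mulVec_self (c : Mat n) : inner ℂ (WithLp.toLp 2 (c *ᵥ x)) (WithLp.toLp 2 (c *ᵥ x)) =
      star x ⬝ᵥ ((cᴴ * c) *ᵥ x) := by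
    rw [EuclideanSpace.inner_toLp_toLp, dotProduct_comm, Matrix.star_mulVec,
      ← Matrix.dotProduct_mulVec, Matrix.mulVec_mulVec]
  rw [norm_eq_sqrt_re_inner (𝕜 := ℂ), norm_eq_sqrt_re_inner (𝕜 := ℂ), inner_mulVec_self a, h,
    inner_mulVec_self b]

theorem trace_eq_sum_inner_mulVec (a : Mat n)
    (v : OrthonormalBasis (Fin n) ℂ (EuclideanSpace ℂ (Fin n))) :
    a.trace = ∑ i, inner ℂ (v i) (WithLp.toLp 2 (a *ᵥ (v i).ofLp)) := by
  rw [← Matrix.trace_toLin_eq a (EuclideanSpace.basisFun (Fin n) ℂ).toBasis,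
    ← Matrix.toEuclideanLin_eq_toLin_orthonormal, LinearMap.trace_eq_sum_inner _ v]
  rfl

/- In an eigenbasis `v` of `|b|` with eigenvalues `λ`, one has `‖b vᵢ‖ = ‖|b| vᵢ‖ = λᵢ`, and
`Tr (c b)` is the sum of the `⟨vᵢ, c b vᵢ⟩`. -/
theorem norm_trace_mul_le (c b : Mat n) : ‖(c * b).trace‖ ≤ opNorm c * traceNorm b := by
  have hpos := posSemidef_sqrt_conjTranspose_mul_self b
  set v := hpos.isHermitian.eigenvectorBasis
  set eig := hpos.isHermitian.eigenvalues
  have norm_mulVec_eigenvector (i : Fin n) : ‖WithLp.toLp 2 (b *ᵥ (v i).ofLp)‖ = eig i := by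
    rw [norm_mulVec_eq_of_conjTranspose_mul_self_eq (conjTranspose_sqrt_mul_sqrt b).symm,
      hpos.isHermitian.mulVec_eigenvectorBasis, WithLp.toLp_smul, WithLp.toLp_ofLp, norm_smul,
      v.norm_eq_one, mul_one, Real.norm_of_nonneg (hpos.eigenvalues_nonneg i)]
  have traceNorm_eq : traceNorm b = ∑ i, eig i := by
    rw [traceNorm, hpos.isHermitian.trace_eq_sum_eigenvalues]
    simp [eig]
  rw [trace_eq_sum_inner_mulVec _ v, traceNorm_eq, Finset.mul_sum]
  refine norm_sum_le_of_le _ fun i _ => ?_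
  calc ‖inner ℂ (v i) (WithLp.toLp 2 ((c * b) *ᵥ (v i).ofLp))‖
      ≤ ‖v i‖ * ‖WithLp.toLp 2 ((c * b) *ᵥ (v i).ofLp)‖ := norm_inner_le_norm _ _
    _ = ‖WithLp.toLp 2 (c *ᵥ (b *ᵥ (v i).ofLp))‖ := by
        rw [v.norm_eq_one, one_mul, Matrix.mulVec_mulVec]
    _ ≤ opNorm c * ‖WithLp.toLp 2 (b *ᵥ (v i).ofLp)‖ := norm_mulVec_le_opNorm_mul _ _
    _ = opNorm c * eig i := by rw [norm_mulVec_eigenvector]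

theorem norm_apply_le_traceNorm (b : Mat n) (j l : Fin n) : ‖b j l‖ ≤ traceNorm b := by
  have h := norm_trace_mul_le (Matrix.single l j 1) b
  rw [Matrix.trace_single_mul, one_smul] at h
  exact h.trans (mul_le_of_le_one_left (traceNorm_nonneg b) (opNorm_single_one_le l j))

end TraceNorm

section ProjectiveNorm

variable {n : ℕ}

theorem exists_eq_sum_kronecker (x : Mat2 n) :
    ∃ (k : ℕ) (a b : Fin k → Mat n), x = ∑ i, a i ⊗ₖ b i := by
  let e := (Fintype.equivFin ((Fin n × Fin n) × (Fin n × Fin n))).symm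
  refine ⟨_, fun i => Matrix.single (e i).1.1 (e i).2.1 (x (e i).1 (e i).2),
    fun i => Matrix.single (e i).1.2 (e i).2.2 1, ?_⟩
  simp only [Matrix.single_kronecker_single, mul_one, Prod.mk.eta]
  rw [e.sum_comp (fun p => Matrix.single p.1 p.2 (x p.1 p.2)), Fintype.sum_prod_type]
  exact Matrix.matrix_eq_sum_single x

theorem sum_opNorm_mul_traceNorm_nonneg {k : ℕ} (a b : Fin k → Mat n) :
    0 ≤ ∑ i, opNorm (a i) * traceNorm (b i) :=
  Finset.sum_nonneg fun _ _ => mul_nonneg (opNorm_nonneg _) (traceNorm_nonneg _)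

theorem projNorm_nonneg (x : Mat2 n) : 0 ≤ projNorm x := by
  refine Real.sInf_nonneg ?_
  rintro _ ⟨k, a, b, -, rfl⟩
  exact sum_opNorm_mul_traceNorm_nonneg a b

theorem projNorm_kronecker_le (a b : Mat n) : projNorm (a ⊗ₖ b) ≤ opNorm a * traceNorm b := by
  refine csInf_le ⟨0, ?_⟩ ⟨1, fun _ => a, fun _ => b, by simp, by simp⟩
  rintro _ ⟨k, a, b, -, rfl⟩
  exact sum_opNorm_mul_traceNorm_nonneg a b

theorem norm_le_projNorm_of_kronecker {E : Type*} [SeminormedAddCommGroup E] (f : Mat2 n →+ E)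
    (hf : ∀ a b, ‖f (a ⊗ₖ b)‖ ≤ opNorm a * traceNorm b) (x : Mat2 n) : ‖f x‖ ≤ projNorm x := by
  obtain ⟨k, a, b, hx⟩ := exists_eq_sum_kronecker x
  refine le_csInf ⟨_, k, a, b, hx, rfl⟩ ?_
  rintro _ ⟨k, a, b, rfl, rfl⟩
  rw [map_sum]
  exact norm_sum_le_of_le _ fun i _ => hf (a i) (b i)

theorem norm_apply_le_projNorm (x : Mat2 n) (p q : Fin n × Fin n) : ‖x p q‖ ≤ projNorm x := by
  refine norm_le_projNorm_of_kronecker (Matrix.entryAddMonoidHom ℂ p q) (fun a b => ?_) x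
  rw [Matrix.entryAddMonoidHom_apply, Matrix.kronecker_apply, norm_mul]
  exact mul_le_mul (norm_apply_le_opNorm a _ _) (norm_apply_le_traceNorm b _ _) (norm_nonneg _)
    (opNorm_nonneg a)

theorem projNorm_pos {x : Mat2 n} (hx : x ≠ 0) : 0 < projNorm x := by
  contrapose! hx
  ext p q
  exact norm_le_zero_iff.1 ((norm_apply_le_projNorm x p q).trans hx)

end ProjectiveNorm

section DualNorm

variable {n : ℕ}

theorem alphaNorm_nonneg (ρ : Mat2 n) : 0 ≤ alphaNorm ρ := by
  refine Real.sSup_nonneg ?_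
  rintro _ ⟨a, -, rfl⟩
  exact div_nonneg (norm_nonneg _) (projNorm_nonneg a)

theorem norm_trace_mul_le_sum_norm_mul_projNorm (ρ x : Mat2 n) :
    ‖(ρ * x).trace‖ ≤ (∑ p, ∑ q, ‖ρ p q‖) * projNorm x := by
  simp only [Matrix.trace, Matrix.diag_apply, Matrix.mul_apply, Finset.sum_mul]
  refine norm_sum_le_of_le _ fun p _ => norm_sum_le_of_le _ fun q _ => ?_
  rw [norm_mul]
  gcongr
  exact norm_apply_le_projNorm x q p

theorem norm_trace_mul_le_alphaNorm_mul_projNorm (ρ x : Mat2 n) :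
    ‖(ρ * x).trace‖ ≤ alphaNorm ρ * projNorm x := by
  rcases eq_or_ne x 0 with rfl | hx
  · simpa using mul_nonneg (alphaNorm_nonneg ρ) (projNorm_nonneg 0)
  rw [← div_le_iff₀ (projNorm_pos hx)]
  refine le_csSup ⟨∑ p, ∑ q, ‖ρ p q‖, ?_⟩ ⟨x, hx, rfl⟩
  rintro _ ⟨a, ha, rfl⟩
  exact (div_le_iff₀ (projNorm_pos ha)).2 (norm_trace_mul_le_sum_norm_mul_projNorm ρ a)

theorem norm_trace_mul_kronecker_le (ρ : Mat2 n) (a b : Mat n) :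
    ‖(ρ * a ⊗ₖ b).trace‖ ≤ alphaNorm ρ * (opNorm a * traceNorm b) :=
  (norm_trace_mul_le_alphaNorm_mul_projNorm ρ _).trans
    (mul_le_mul_of_nonneg_left (projNorm_kronecker_le a b) (alphaNorm_nonneg ρ))

theorem alphaNorm_le_one_of_kronecker {ρ : Mat2 n}
    (h : ∀ a b, ‖(ρ * a ⊗ₖ b).trace‖ ≤ opNorm a * traceNorm b) : alphaNorm ρ ≤ 1 := by
  refine Real.sSup_le ?_ zero_le_one
  rintro _ ⟨a, ha, rfl⟩
  exact (div_le_one (projNorm_pos ha)).2 <| norm_le_projNorm_of_kronecker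
    ((Matrix.traceAddMonoidHom _ ℂ).comp (AddMonoidHom.mulLeft ρ)) h a

end DualNorm

section Weyl

variable {G : Type*} [Fintype G] [DecidableEq G] [AddCommGroup G]

/-- The Weyl unitaries of a finite abelian group `G`: translations of `G` followed by
multiplication by a character. They span all matrices over `G` and are orthogonal for the
Hilbert–Schmidt inner product. -/
noncomputable def weyl (t : AddChar G ℂ × G) : Matrix G G ℂ :=
  Matrix.diagonal t.1 * (Equiv.addRight t.2).permMatrix ℂ

theorem weyl_apply (t : AddChar G ℂ × G) (i k : G) :
    weyl t i k = if t.2 = k - i then t.1 i else 0 := by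
  simp [weyl, PEquiv.toMatrix_apply, eq_sub_iff_add_eq', eq_comm]

theorem weyl_mem_unitaryGroup (t : AddChar G ℂ × G) : weyl t ∈ Matrix.unitaryGroup G ℂ := by
  refine mul_mem (Matrix.mem_unitaryGroup_iff.2 ?_) (Matrix.mem_unitaryGroup_iff.2 ?_)
  · rw [Matrix.star_eq_conjTranspose, Matrix.diagonal_conjTranspose, Matrix.diagonal_mul_diagonal,
      ← Matrix.diagonal_one]
    congr 1
    ext i
    simp [Complex.mul_conj', AddChar.norm_apply]
  · rw [Matrix.star_eq_conjTranspose, Matrix.conjTranspose_permMatrix, ← Matrix.permMatrix_mul,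
      inv_mul_cancel, Matrix.permMatrix_one]

theorem sum_addChar_star_mul (i j : G) :
    ∑ ψ : AddChar G ℂ, star (ψ i) * ψ j = if i = j then (Fintype.card G : ℂ) else 0 := by
  simp_rw [Complex.star_def, ← AddChar.map_neg_eq_conj, ← AddChar.map_add_eq_mul,
    AddChar.sum_apply_eq_ite, neg_add_eq_zero]

theorem sum_star_weyl_mul_weyl (i k j l : G) :
    ∑ t, star (weyl t i k) * weyl t j l = if (i, k) = (j, l) then (Fintype.card G : ℂ) else 0 := by
  have sum_characters (h : G) : ∑ ψ : AddChar G ℂ, star (weyl (ψ, h) i k) * weyl (ψ, h) j l =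
      if h = k - i then if h = l - j then if i = j then (Fintype.card G : ℂ) else 0 else 0
      else 0 := by
    simp only [weyl_apply]
    split_ifs with _ _ hij
    · rw [sum_addChar_star_mul, if_pos hij]
    · rw [sum_addChar_star_mul, if_neg hij]
    all_goals simp
  simp only [Fintype.sum_prod_type_right, sum_characters, Finset.sum_ite_eq', Finset.mem_univ,
    if_true, Prod.mk.injEq]
  by_cases hij : i = j <;> simp [hij]

/-- The matrix of the Fourier–Weyl transform `c ↦ (∑ i k, (weyl t) i k * c (i, k))ₜ`. -/
noncomputable def weylTransform (G : Type*) [Fintype G] [DecidableEq G] [AddCommGroup G] :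
    Matrix (AddChar G ℂ × G) (G × G) ℂ :=
  Matrix.of fun t p => weyl t p.1 p.2

theorem weylTransform_conjTranspose_mul_self :
    (weylTransform G)ᴴ * weylTransform G = (Fintype.card G : ℂ) • 1 := by
  ext p q
  simp only [weylTransform, Matrix.mul_apply, Matrix.conjTranspose_apply, Matrix.of_apply,
    sum_star_weyl_mul_weyl, Matrix.smul_apply, Matrix.one_apply, smul_eq_mul, mul_ite, mul_one,
    mul_zero]

theorem trace_conjTranspose_weylTransform_mul_mul_self_re {m : Type*} [Fintype m]
    (R : Matrix (G × G) m ℂ) :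
    ((weylTransform G * R)ᴴ * (weylTransform G * R)).trace.re =
      Fintype.card G * (Rᴴ * R).trace.re := by
  rw [Matrix.conjTranspose_mul, Matrix.mul_assoc, ← Matrix.mul_assoc _ (weylTransform G),
    weylTransform_conjTranspose_mul_self, Matrix.smul_mul, Matrix.one_mul, Matrix.mul_smul,
    Matrix.trace_smul, smul_eq_mul, ← Complex.ofReal_natCast, Complex.re_ofReal_mul]

end Weyl

section HilbertSchmidtBound

variable {n : ℕ}

/-- The map `φ` on `M_n(ℂ)` with Choi matrix `ρ`, that is, with `ρ = ∑ E_ik ⊗ φ(E_ik)`. -/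
noncomputable def choiMap (ρ : Mat2 n) (a : Mat n) : Mat n :=
  Matrix.of fun j l => ∑ p : Fin n × Fin n, a p.1 p.2 * ρ (p.1, j) (p.2, l)

theorem trace_choiMap_mul (ρ : Mat2 n) (a b : Mat n) :
    (choiMap ρ a * b).trace = (ρ * aᵀ ⊗ₖ b).trace := by
  simp only [choiMap, Matrix.trace, Matrix.diag_apply, Matrix.mul_apply, Matrix.of_apply,
    Finset.sum_mul, Fintype.sum_prod_type]
  calc ∑ j, ∑ l, ∑ i, ∑ k, a i k * ρ (i, j) (k, l) * b l j
      = ∑ i, ∑ j, ∑ l, ∑ k, a i k * ρ (i, j) (k, l) * b l j :=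
        (Finset.sum_congr rfl fun j _ => Finset.sum_comm).trans Finset.sum_comm
    _ = ∑ i, ∑ j, ∑ k, ∑ l, ρ (i, j) (k, l) * (a i k * b l j) := by
        refine Finset.sum_congr rfl fun i _ => Finset.sum_congr rfl fun j _ => ?_
        rw [Finset.sum_comm]
        exact Finset.sum_congr rfl fun k _ => Finset.sum_congr rfl fun l _ => by ring

theorem trace_conjTranspose_choiMap_mul_self_re_le (ρ : Mat2 n) {u : Mat n} (hu : opNorm u ≤ 1) :
    ((choiMap ρ u)ᴴ * choiMap ρ u).trace.re ≤ n * alphaNorm ρ ^ 2 := by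
  set b := choiMap ρ u
  set q := (bᴴ * b).trace.re
  have hq_nonneg : 0 ≤ q := trace_conjTranspose_mul_self_re_nonneg b
  have q_le : q ≤ alphaNorm ρ * traceNorm bᴴ := by
    calc q = (ρ * uᵀ ⊗ₖ bᴴ).trace.re := by
          rw [← trace_choiMap_mul, Matrix.trace_mul_comm]
      _ ≤ alphaNorm ρ * (opNorm uᵀ * traceNorm bᴴ) :=
          (Complex.re_le_norm _).trans (norm_trace_mul_kronecker_le ρ _ _)
      _ ≤ alphaNorm ρ * traceNorm bᴴ :=
          mul_le_mul_of_nonneg_left (mul_le_of_le_one_left (traceNorm_nonneg _)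
            ((opNorm_transpose_le u).trans hu)) (alphaNorm_nonneg ρ)
  have traceNorm_sq : traceNorm bᴴ ^ 2 ≤ n * q := by
    simpa only [Matrix.conjTranspose_conjTranspose, Matrix.trace_mul_comm b] using
      traceNorm_sq_le bᴴ
  have q_sq_le : q * q ≤ n * alphaNorm ρ ^ 2 * q := by
    calc q * q ≤ (alphaNorm ρ * traceNorm bᴴ) ^ 2 := by
          rw [← sq]
          gcongr
      _ = alphaNorm ρ ^ 2 * traceNorm bᴴ ^ 2 := mul_pow _ _ _
      _ ≤ alphaNorm ρ ^ 2 * (n * q) := by gcongr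
      _ = n * alphaNorm ρ ^ 2 * q := by ring
  rcases hq_nonneg.eq_or_lt with h0 | hpos
  · rw [← h0]
    positivity
  · exact le_of_mul_le_mul_right q_sq_le hpos

variable [NeZero n]

theorem sum_trace_conjTranspose_choiMap_weyl_mul_self_re (ρ : Mat2 n) :
    ∑ t, ((choiMap ρ (weyl t))ᴴ * choiMap ρ (weyl t)).trace.re = n * (ρᴴ * ρ).trace.re := by
  let R : Matrix (Fin n × Fin n) (Fin n × Fin n) ℂ :=
    Matrix.of fun p q => ρ (p.1, q.1) (p.2, q.2)
  have choiMap_weyl (t) (j l : Fin n) :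
      choiMap ρ (weyl t) j l = (weylTransform (Fin n) * R) t (j, l) := rfl
  have trace_realign : (Rᴴ * R).trace.re = (ρᴴ * ρ).trace.re := by
    simp only [trace_conjTranspose_mul_self_re, R, Matrix.of_apply, Fintype.sum_prod_type]
    exact Finset.sum_congr rfl fun i _ => Finset.sum_comm
  have parseval := trace_conjTranspose_weylTransform_mul_mul_self_re R
  rw [Fintype.card_fin, trace_realign] at parseval
  rw [← parseval]
  simp only [trace_conjTranspose_mul_self_re, choiMap_weyl, Fintype.sum_prod_type]

theorem trace_conjTranspose_mul_self_re_le_alphaNorm (ρ : Mat2 n) :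
    (ρᴴ * ρ).trace.re ≤ (n * alphaNorm ρ) ^ 2 := by
  have hn : (0 : ℝ) < n := Nat.cast_pos.2 (NeZero.pos n)
  refine le_of_mul_le_mul_left ?_ hn
  calc n * (ρᴴ * ρ).trace.re
      = ∑ t, ((choiMap ρ (weyl t))ᴴ * choiMap ρ (weyl t)).trace.re :=
        (sum_trace_conjTranspose_choiMap_weyl_mul_self_re ρ).symm
    _ ≤ ∑ _t : AddChar (Fin n) ℂ × Fin n, n * alphaNorm ρ ^ 2 :=
        Finset.sum_le_sum fun t _ => trace_conjTranspose_choiMap_mul_self_re_le ρ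
          (opNorm_le_one_of_mem_unitaryGroup (weyl_mem_unitaryGroup t))
    _ = n * (n * alphaNorm ρ) ^ 2 := by
        rw [Finset.sum_const, Finset.card_univ, Fintype.card_prod, AddChar.card_eq,
          Fintype.card_fin, nsmul_eq_mul]
        push_cast
        ring

theorem mem_exposedPoints_alphaNorm_le_one {ρ : Mat2 n} (hρ : alphaNorm ρ ≤ 1)
    (h : (ρᴴ * ρ).trace.re = (n : ℝ) ^ 2) :
    ρ ∈ {σ : Mat2 n | alphaNorm σ ≤ 1}.exposedPoints ℝ := by
  refine mem_exposedPoints_of_forall_trace_le hρ fun σ hσ => ?_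
  calc (σᴴ * σ).trace.re ≤ (n * alphaNorm σ) ^ 2 := trace_conjTranspose_mul_self_re_le_alphaNorm σ
    _ ≤ (n * 1) ^ 2 := by
        have := alphaNorm_nonneg σ
        gcongr
        exact hσ
    _ = (ρᴴ * ρ).trace.re := by rw [mul_one, h]

end HilbertSchmidtBound

section MaximallyEntangled

variable {n : ℕ}

theorem trace_ketBra (x : Fin n × Fin n → ℂ) : (ketBra x).trace = star x ⬝ᵥ x := by
  rw [ketBra, Matrix.trace_vecMulVec, dotProduct_comm]

theorem trace_ketBra_vec {v : Mat n} (hv : v ∈ Matrix.unitaryGroup (Fin n) ℂ) :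
    (ketBra v.vec).trace = n := by
  rw [trace_ketBra, Matrix.star_vec_dotProduct_vec, ← Matrix.star_eq_conjTranspose,
    Matrix.mem_unitaryGroup_iff'.1 hv, Matrix.trace_one, Fintype.card_fin]

theorem trace_ketBra_vec_mul_kronecker (v a b : Mat n) :
    (ketBra v.vec * a ⊗ₖ b).trace = (v * aᵀ * vᴴ * b).trace := by
  rw [ketBra, Matrix.trace_mul_comm, Matrix.mul_vecMulVec, Matrix.trace_vecMulVec,
    dotProduct_comm, Matrix.kronecker_mulVec_vec, Matrix.star_vec_dotProduct_vec,
    Matrix.mul_assoc b, ← Matrix.mul_assoc, Matrix.trace_mul_comm, ← Matrix.mul_assoc]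

theorem trace_conjTranspose_ketBra_mul_self (x : Fin n × Fin n → ℂ) :
    ((ketBra x)ᴴ * ketBra x).trace = (ketBra x).trace ^ 2 := by
  simp only [ketBra, Matrix.conjTranspose_vecMulVec, star_star, Matrix.vecMulVec_mul_vecMulVec,
    Matrix.trace_vecMulVec, dotProduct_smul, dotProduct_comm (star x), smul_eq_mul, sq]

theorem alphaNorm_ketBra_vec_le {v : Mat n} (hv : v ∈ Matrix.unitaryGroup (Fin n) ℂ) :
    alphaNorm (ketBra v.vec) ≤ 1 := by
  refine alphaNorm_le_one_of_kronecker fun a b => ?_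
  rw [trace_ketBra_vec_mul_kronecker]
  refine (norm_trace_mul_le _ _).trans (mul_le_mul_of_nonneg_right ?_ (traceNorm_nonneg b))
  rw [← Matrix.star_eq_conjTranspose, opNorm_mul_mem_unitaryGroup _ (Unitary.star_mem hv),
    opNorm_mem_unitaryGroup_mul _ hv]
  exact opNorm_transpose_le a

theorem one_le_alphaNorm_of_trace_eq [NeZero n] {ρ : Mat2 n} (h : ρ.trace = n) :
    1 ≤ alphaNorm ρ := by
  have hn : (0 : ℝ) < n := Nat.cast_pos.2 (NeZero.pos n)
  refine le_of_mul_le_mul_right ?_ hn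
  calc 1 * (n : ℝ) = ‖(ρ * (1 : Mat n) ⊗ₖ (1 : Mat n)).trace‖ := by
        rw [Matrix.one_kronecker_one, mul_one, h, Complex.norm_natCast, one_mul]
    _ ≤ alphaNorm ρ * (opNorm (1 : Mat n) * traceNorm (1 : Mat n)) :=
        norm_trace_mul_kronecker_le ρ 1 1
    _ ≤ alphaNorm ρ * n := by
        rw [traceNorm_one]
        exact mul_le_mul_of_nonneg_left (mul_le_of_le_one_left hn.le opNorm_one_le)
          (alphaNorm_nonneg ρ)

theorem ketBra_vec_mem_choiSet [NeZero n] {v : Mat n} (hv : v ∈ Matrix.unitaryGroup (Fin n) ℂ) :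
    ketBra v.vec ∈ choiSet n := by
  have hpos : (ketBra v.vec).PosSemidef := Matrix.posSemidef_vecMulVec_self_star _
  exact ⟨hpos.isHermitian, le_antisymm (alphaNorm_ketBra_vec_le hv)
    (one_le_alphaNorm_of_trace_eq (trace_ketBra_vec hv)),
    fun x y => hpos.dotProduct_mulVec_nonneg _, trace_ketBra_vec hv⟩

theorem exists_mem_unitaryGroup_sum_tensorVec_eq_vec
    (f g : OrthonormalBasis (Fin n) ℂ (EuclideanSpace ℂ (Fin n))) :
    ∃ v ∈ Matrix.unitaryGroup (Fin n) ℂ,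
      ∑ k, tensorVec (fun i => f k i) (fun j => g k j) = v.vec := by
  let e := EuclideanSpace.basisFun (Fin n) ℂ
  refine ⟨e.toBasis.toMatrix g * (e.toBasis.toMatrix f)ᵀ,
    mul_mem (e.toMatrix_orthonormalBasis_mem_unitary g)
      (Matrix.transpose_mem_unitaryGroup_iff.2 (e.toMatrix_orthonormalBasis_mem_unitary f)), ?_⟩
  ext p
  rw [Finset.sum_apply]
  exact Finset.sum_congr rfl fun k _ => mul_comm _ _

theorem smul_ketBra_inv_sqrt_smul [NeZero n] (x : Fin n × Fin n → ℂ) :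
    (n : ℂ) • ketBra (((1 / Real.sqrt n : ℝ) : ℂ) • x) = ketBra x := by
  have hc : (n : ℂ) * (((1 / Real.sqrt n : ℝ) : ℂ) * ((1 / Real.sqrt n : ℝ) : ℂ)) = 1 := by
    rw [← Complex.ofReal_mul, div_mul_div_comm, Real.mul_self_sqrt n.cast_nonneg]
    have := NeZero.ne (n : ℂ)
    push_cast
    field_simp
  rw [ketBra, ketBra, star_smul, Matrix.smul_vecMulVec, Matrix.vecMulVec_smul, smul_smul,
    smul_smul, Complex.star_def, Complex.conj_ofReal, mul_assoc, hc, one_smul]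

theorem IsMaximallyEntangled.exists_smul_ketBra_eq [NeZero n] {x : Fin n × Fin n → ℂ}
    (hx : IsMaximallyEntangled x) :
    ∃ v ∈ Matrix.unitaryGroup (Fin n) ℂ, (n : ℂ) • ketBra x = ketBra v.vec := by
  obtain ⟨f, g, rfl⟩ := hx
  obtain ⟨v, hv, hfg⟩ := exists_mem_unitaryGroup_sum_tensorVec_eq_vec f g
  exact ⟨v, hv, by rw [hfg, smul_ketBra_inv_sqrt_smul]⟩

end MaximallyEntangled

theorem mem_exposedPoints_of_subset {𝕜 E : Type*} [TopologicalSpace 𝕜] [Ring 𝕜]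
    [PartialOrder 𝕜] [AddCommMonoid E] [TopologicalSpace E] [Module 𝕜 E] {A B : Set E} {x : E}
    (hAB : A ⊆ B) (hA : x ∈ A) (hx : x ∈ B.exposedPoints 𝕜) : x ∈ A.exposedPoints 𝕜 :=
  ⟨hA, hx.2.imp fun _ hl y hy => hl y (hAB hy)⟩

theorem choiSet_subset_alphaNorm_le_one (n : ℕ) : choiSet n ⊆ {ρ | alphaNorm ρ ≤ 1} :=
  fun _ hρ => hρ.2.1.le

theorem IsSymmetry.mem_unitaryGroup {n : ℕ} {s : Mat2 n} (hs : IsSymmetry s) :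
    s ∈ Matrix.unitaryGroup (Fin n × Fin n) ℂ :=
  Matrix.mem_unitaryGroup_iff.2 (by rw [Matrix.star_eq_conjTranspose, hs.1.eq, hs.2])

theorem mainTheorem4_general (n : ℕ) [NeZero n] :
    (∀ u : Mat2 n, alphaNorm u ≤ 1 → u ∈ Matrix.unitaryGroup (Fin n × Fin n) ℂ →
      u ∈ {ρ : Mat2 n | alphaNorm ρ ≤ 1}.exposedPoints ℝ) ∧
    (∀ x : Fin n × Fin n → ℂ, IsMaximallyEntangled x → (n : ℂ) • ketBra x ∈ choiSet n ∧
      (n : ℂ) • ketBra x ∈ {ρ : Mat2 n | alphaNorm ρ ≤ 1}.exposedPoints ℝ) := by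
  refine ⟨fun u hα hu => mem_exposedPoints_alphaNorm_le_one hα ?_, fun x hx => ?_⟩
  · rw [← Matrix.star_eq_conjTranspose, Matrix.mem_unitaryGroup_iff'.1 hu, Matrix.trace_one,
      Fintype.card_prod, Fintype.card_fin, ← sq, Complex.natCast_re, Nat.cast_pow]
  · obtain ⟨v, hv, hxv⟩ := hx.exists_smul_ketBra_eq
    rw [hxv]
    refine ⟨ketBra_vec_mem_choiSet hv,
      mem_exposedPoints_alphaNorm_le_one (alphaNorm_ketBra_vec_le hv) ?_⟩
    rw [trace_conjTranspose_ketBra_mul_self, trace_ketBra_vec hv, ← Nat.cast_pow,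
      Complex.natCast_re, Nat.cast_pow]

theorem mainTheorem4 :
    (∀ s : Mat2 3, s ∈ choiSet 3 → IsSymmetry s → s ∈ (choiSet 3).exposedPoints ℝ) ∧
    (∀ x : Fin 3 × Fin 3 → ℂ, IsMaximallyEntangled x →
      (3 : ℂ) • ketBra x ∈ (choiSet 3).exposedPoints ℝ) := by
  have restrict {ρ : Mat2 3} :=
    mem_exposedPoints_of_subset (𝕜 := ℝ) (x := ρ) (choiSet_subset_alphaNorm_le_one 3)
  obtain ⟨unitary_exposed, entangled_exposed⟩ := mainTheorem4_general 3
  exact ⟨fun s hs hsymm => restrict hs (unitary_exposed s hs.2.1.le hsymm.mem_unitaryGroup),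
    fun x hx => restrict (entangled_exposed x hx).1 (entangled_exposed x hx).2⟩
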